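/- Theorem 1.3 (Convergence of the hyperbolic combinatorial Ricci flow). Let $\mathcal T=(V,E,F)$ be an infinite disk triangulation, i.e. a locally finite simplicial triangulation, with infinitely many vertices, of a surface without boundary that is simply connected and has exactly one end. Let $\Phi\colon E\to[0,\pi/2]$. For a circle-packing metric $r\colon V\to(0,\infty)$, give each edge $\{i,j\}\in E$ the hyperbolic length $$l_{ij}=\cosh^{-1}\bigl(\cosh r_i\cosh r_j+\cos\Phi_{ij}\,\sinh r_i\sinh r_j\bigr),$$ let $\theta_i^{jk}$ be the inner angle at $i$ of the hyperbolic triangle with side lengths $l_{ij},l_{jk},l_{ik}$ for each face $\{i,j,k\}\in F$, and let $$K_i(r)=2\pi-\sum_{\{i,j,k\}\in F}\theta_i^{jk}$$ be the discrete Gaussian curvature at $i$, the sum being over the faces containing $i$. Let $r^0$ be a circle-packing metric with $K_i(r^0)\le 0$ for all $i\in V$. Then there exists a family of circle-packing metrics $r(t)$, $t\in[0,\infty)$, with $r(0)=r^0$, solving the hyperbolic combinatorial Ricci flow $$\frac{\mathrm d r_i}{\mathrm d t}=-K_i(r(t))\,\sinh r_i(t)\qquad\text{for all } i\in V,\ t\ge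 0,$$ and a circle-packing metric $r^\ast$ with $K_i(r^\ast)=0$ for all $i\in V$, such that $r_i(t)\to r_i^\ast$ as $t\to\infty$ for every $i\in V$. -/

import Mathlib

noncomputable section

namespace CRF

variable {V : Type*}

/-- The geometric realization of an abstract simplicial complex with vertex set `V`: the
barycentric coordinate functions supported in some simplex. It is topologized as a subspace of
`V → ℝ`; for a locally finite complex this is the usual topology of the polyhedron. -/
def realization (T : AbstractSimplicialComplex V) : Set (V → ℝ) :=
  {x | (∀ i, 0 ≤ x i) ∧ ∃ s ∈ T.faces, (∀ i, i ∉ s → x i = 0) ∧ ∑ i ∈ s, x i = 1}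

/-- `{i, j}` is an edge of the complex. -/
def IsEdge (T : AbstractSimplicialComplex V) (i j : V) : Prop :=
  i ≠ j ∧ ∃ s ∈ T.faces, (s : Set V) = {i, j}

/-- `{i, j, k}` is a (triangular) face of the complex. -/
def IsTriangle (T : AbstractSimplicialComplex V) (i j k : V) : Prop :=
  i ≠ j ∧ i ≠ k ∧ j ≠ k ∧ ∃ s ∈ T.faces, (s : Set V) = {i, j, k}

/-- The 1-skeleton `(V, E)` of the complex. -/
def skeleton (T : AbstractSimplicialComplex V) : SimpleGraph V where
  Adj i j := IsEdge T i j
  symm := ⟨fun _ _ h => ⟨h.1.symm, by simpa only [Set.pair_comm] using h.2⟩⟩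
  loopless := ⟨fun _ h => h.1 rfl⟩

/-- A locally finite triangulation of a surface (without boundary): a locally finite simplicial
complex, with vertices, edges and triangles as its only simplices, whose realization is locally
homeomorphic to the Euclidean plane. -/
structure IsSurfaceTriangulation (T : AbstractSimplicialComplex V) : Prop where
  card_le : ∀ s ∈ T.faces, s.card ≤ 3
  locallyFinite : ∀ i : V, {s ∈ T.faces | i ∈ s}.Finite
  surface : Nonempty (ChartedSpace (EuclideanSpace ℝ (Fin 2)) (realization T))

/-- An infinite disk triangulation: a locally finite triangulation of a surface that has
infinitely many vertices, is simply connected (in particular nonempty and connected) and has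
exactly one end. -/
structure IsInfiniteDiskTriangulation (T : AbstractSimplicialComplex V) : Prop extends
    IsSurfaceTriangulation T where
  infinite : Infinite V
  simplyConnected : SimplyConnectedSpace (realization T)
  oneEnded : ∃! e, e ∈ (skeleton T).end

/-- The hyperbolic length of the edge `{i, j}` determined by the radii `r` and the intersection
angles `Φ`. -/
def edgeLength (Φ : Sym2 V → ℝ) (r : V → ℝ) (i j : V) : ℝ :=
  Real.arcosh (Real.cosh (r i) * Real.cosh (r j)
    + Real.cos (Φ s(i, j)) * Real.sinh (r i) * Real.sinh (r j))

/-- The inner angle at `i` of the hyperbolic triangle `{i, j, k}` whose side lengths are given by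
`edgeLength` (hyperbolic law of cosines). -/
def innerAngle (Φ : Sym2 V → ℝ) (r : V → ℝ) (i j k : V) : ℝ :=
  Real.arccos
    ((Real.cosh (edgeLength Φ r i j) * Real.cosh (edgeLength Φ r i k)
        - Real.cosh (edgeLength Φ r j k))
      / (Real.sinh (edgeLength Φ r i j) * Real.sinh (edgeLength Φ r i k)))

theorem edgeLength_comm (Φ : Sym2 V → ℝ) (r : V → ℝ) (i j : V) :
    edgeLength Φ r i j = edgeLength Φ r j i := by
  unfold edgeLength
  rw [Sym2.eq_swap]
  congr 1
  ring

theorem innerAngle_comm (Φ : Sym2 V → ℝ) (r : V → ℝ) (i j k : V) :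
    innerAngle Φ r i j k = innerAngle Φ r i k j := by
  unfold innerAngle
  rw [edgeLength_comm Φ r j k, mul_comm (Real.cosh (edgeLength Φ r i j)),
    mul_comm (Real.sinh (edgeLength Φ r i j))]

/-- The inner angle at `i` as a function of the unordered opposite edge `{j, k}`. -/
def innerAngleOpp (Φ : Sym2 V → ℝ) (r : V → ℝ) (i : V) : Sym2 V → ℝ :=
  Sym2.lift ⟨innerAngle Φ r i, innerAngle_comm Φ r i⟩

/-- The edges `{j, k}` opposite to `i` in the faces `{i, j, k}` that contain `i`; they correspond
one-to-one to those faces. -/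
def oppositeEdges (T : AbstractSimplicialComplex V) (i : V) : Set (Sym2 V) :=
  {e | ∃ j k, e = s(j, k) ∧ IsTriangle T i j k}

/-- The discrete Gaussian curvature `K i = 2π - ∑ θ_i^{jk}`, summed over the faces `{i, j, k}` at
`i` (a finite sum when `T` is locally finite). -/
def curvature (T : AbstractSimplicialComplex V) (Φ : Sym2 V → ℝ) (r : V → ℝ) (i : V) : ℝ :=
  2 * Real.pi - ∑ᶠ e ∈ oppositeEdges T i, innerAngleOpp Φ r i e

/-- A circle-packing metric: a positive radius at every vertex. -/
def IsCirclePackingMetric (r : V → ℝ) : Prop := ∀ i, 0 < r i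

/-- `r` is a solution on `[0, ∞)` of the hyperbolic combinatorial Ricci flow
`dr_i/dt = -K_i sinh r_i` (with the one-sided derivative at `t = 0`). -/
structure IsHyperbolicCRF (T : AbstractSimplicialComplex V) (Φ : Sym2 V → ℝ)
    (r : ℝ → V → ℝ) : Prop where
  metric : ∀ t, 0 ≤ t → IsCirclePackingMetric (r t)
  flow : ∀ t, 0 ≤ t → ∀ i, HasDerivWithinAt (fun s => r s i)
    (-curvature T Φ (r t) i * Real.sinh (r t i)) (Set.Ici 0) t

end CRF

end

/-! The flow is a cooperative system. Since all `cos Φ` lie in `[0, 1]`, the angle at `i` is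
nondecreasing in the radii of the other vertices, so `-K i * sinh (r i)` is too
(`cosAngle_antitoneOn`, `innerAngle_le_innerAngle`). The condition `K ≤ 0` makes the initial metric
a subsolution. A supersolution `M` is found vertex by vertex: the angle at `i` tends to `0` as `r i
→ ∞`, uniformly in the other radii, and `i` lies in finitely many faces
(`exists_forall_curvature_pos`).

Between the two barriers the flow is solved by monotone iteration. With `L i` large, `F i r + L i *
r i` is nondecreasing in all radii, so the integral form of `r' = (F r + L r) - L r` is an
order-preserving operator on a complete lattice and has a fixed point by Knaster–Tarski. No
Lipschitz bound uniform over the vertices is needed. The solution is nondecreasing in time and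
bounded by `M`; hence it converges, its limit is stationary, and `sinh > 0` turns stationarity into
zero curvature. -/

noncomputable section

namespace CRF

open MeasureTheory Filter Topology

/-! ### Scalar linear equations with monotone forcing -/

/-- The solution `v` of `v' = h - L v`, `v 0 = a`, given by variation of constants. -/
def duhamel (L a : ℝ) (h : ℝ → ℝ) (t : ℝ) : ℝ :=
  Real.exp (-(L * t)) * (a + ∫ s in (0 : ℝ)..t, Real.exp (L * s) * h s)

theorem duhamel_zero (L a : ℝ) (h : ℝ → ℝ) : duhamel L a h 0 = a := by
  simp [duhamel]

theorem exp_mul_duhamel (L a : ℝ) (h : ℝ → ℝ) (t : ℝ) :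
    Real.exp (L * t) * duhamel L a h t = a + ∫ s in (0 : ℝ)..t, Real.exp (L * s) * h s := by
  rw [duhamel, ← mul_assoc, ← Real.exp_add]
  simp

theorem intervalIntegrable_exp_mul {h : ℝ → ℝ} (hh : Monotone h) (L a b : ℝ) :
    IntervalIntegrable (fun s => Real.exp (L * s) * h s) volume a b :=
  (hh.intervalIntegrable).continuousOn_mul (by fun_prop)

theorem integral_exp_mul_const {L : ℝ} (hL : 0 < L) (c s t : ℝ) :
    ∫ x in s..t, Real.exp (L * x) * c = (Real.exp (L * t) - Real.exp (L * s)) * (c / L) := by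
  rw [intervalIntegral.integral_mul_const, intervalIntegral.integral_comp_mul_left (fun x => Real.exp x) hL.ne',
    integral_exp, smul_eq_mul]
  field_simp

theorem le_integral_exp_mul {L : ℝ} (hL : 0 < L) {h : ℝ → ℝ} (hh : Monotone h) {s t : ℝ}
    (hst : s ≤ t) :
    (Real.exp (L * t) - Real.exp (L * s)) * (h s / L) ≤ ∫ x in s..t, Real.exp (L * x) * h x := by
  rw [← integral_exp_mul_const hL]
  refine intervalIntegral.integral_mono_on hst
    (Continuous.intervalIntegrable (by fun_prop) _ _) (intervalIntegrable_exp_mul hh _ _ _) ?_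
  intro x hx
  exact mul_le_mul_of_nonneg_left (hh hx.1) (Real.exp_pos _).le

theorem integral_exp_mul_le {L : ℝ} (hL : 0 < L) {h : ℝ → ℝ} (hh : Monotone h) {s t : ℝ}
    (hst : s ≤ t) :
    ∫ x in s..t, Real.exp (L * x) * h x ≤ (Real.exp (L * t) - Real.exp (L * s)) * (h t / L) := by
  rw [← integral_exp_mul_const hL]
  refine intervalIntegral.integral_mono_on hst
    (intervalIntegrable_exp_mul hh _ _ _) (Continuous.intervalIntegrable (by fun_prop) _ _) ?_
  intro x hx
  exact mul_le_mul_of_nonneg_left (hh hx.2) (Real.exp_pos _).le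

/-- `duhamel L a h t` is a weighted average of `a` and the values of `h / L` on `[0, t]`, none of
which exceeds `h t / L`. -/
theorem duhamel_le {L a : ℝ} (hL : 0 < L) {h : ℝ → ℝ} (hh : Monotone h)
    (ha : ∀ t, a ≤ h t / L) {t : ℝ} (ht : 0 ≤ t) : duhamel L a h t ≤ h t / L := by
  refine le_of_mul_le_mul_left ?_ (Real.exp_pos (L * t))
  have h1 := integral_exp_mul_le hL hh ht
  rw [exp_mul_duhamel]
  simp only [mul_zero, Real.exp_zero] at h1
  linarith [ha t]

/-- Formally `v' = h - L v ≥ 0` by `duhamel_le`. The argument is run in integrated form because `h`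
may be discontinuous. -/
theorem duhamel_monotoneOn {L a : ℝ} (hL : 0 < L) {h : ℝ → ℝ} (hh : Monotone h)
    (ha : ∀ t, a ≤ h t / L) : MonotoneOn (duhamel L a h) (Set.Ici 0) := by
  intro s hs t _ hst
  refine le_of_mul_le_mul_left ?_ (Real.exp_pos (L * t))
  have h1 := le_integral_exp_mul hL hh hst
  have h2 := exp_mul_duhamel L a h s
  have h3 : Real.exp (L * s) ≤ Real.exp (L * t) :=
    Real.exp_le_exp.2 (mul_le_mul_of_nonneg_left hst hL.le)
  have h4 := mul_le_mul_of_nonneg_left (duhamel_le hL hh ha hs) (sub_nonneg.2 h3)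
  rw [exp_mul_duhamel, ← intervalIntegral.integral_add_adjacent_intervals
    (intervalIntegrable_exp_mul hh L 0 s) (intervalIntegrable_exp_mul hh L s t)]
  linarith

theorem duhamel_mono {L a : ℝ} {h k : ℝ → ℝ} (hh : Monotone h) (hk : Monotone k)
    (hhk : ∀ t, h t ≤ k t) {t : ℝ} (ht : 0 ≤ t) : duhamel L a h t ≤ duhamel L a k t := by
  unfold duhamel
  gcongr
  refine intervalIntegral.integral_mono_on ht (intervalIntegrable_exp_mul hh _ _ _)
    (intervalIntegrable_exp_mul hk _ _ _) fun x _ => ?_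
  exact mul_le_mul_of_nonneg_left (hhk x) (Real.exp_pos _).le

theorem continuous_duhamel {h : ℝ → ℝ} (hh : Monotone h) (L a : ℝ) :
    Continuous (duhamel L a h) := by
  have := intervalIntegral.continuous_primitive (μ := volume)
    (fun s t => intervalIntegrable_exp_mul hh L s t) 0
  unfold duhamel
  fun_prop

theorem hasDerivAt_duhamel {h : ℝ → ℝ} (hh : Continuous h) (L a t : ℝ) :
    HasDerivAt (duhamel L a h) (h t - L * duhamel L a h t) t := by
  have hc : Continuous fun s => Real.exp (L * s) * h s := by fun_prop
  have h1 : HasDerivAt (fun t => a + ∫ s in (0 : ℝ)..t, Real.exp (L * s) * h s)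
      (Real.exp (L * t) * h t) t :=
    (intervalIntegral.integral_hasDerivAt_right (hc.intervalIntegrable _ _)
      (hc.stronglyMeasurableAtFilter _ _) hc.continuousAt).const_add a
  have h2 : HasDerivAt (fun t => Real.exp (-(L * t))) (Real.exp (-(L * t)) * -(L * 1)) t :=
    (((hasDerivAt_id t).const_mul L).neg).exp
  refine (h2.mul h1).congr_deriv ?_
  have h3 : Real.exp (-(L * t)) * Real.exp (L * t) = 1 := by rw [← Real.exp_add]; simp
  unfold duhamel
  linear_combination h t * h3

/-- The limit of a convergent solution of an autonomous equation is stationary. -/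
theorem eq_zero_of_tendsto_of_hasDerivWithinAt {f g : ℝ → ℝ} {a c : ℝ}
    (hf : Tendsto f atTop (𝓝 a)) (hg : Tendsto g atTop (𝓝 c))
    (hd : ∀ t, 0 ≤ t → HasDerivWithinAt f (g t) (Set.Ici 0) t) : c = 0 := by
  -- Mean value theorem on `[t, t + 1]`: `g` takes the value `f (t + 1) - f t`, which tends to `0`,
  -- at points going to infinity. For negative `t` the witness is a dummy.
  have hmv : ∀ t : ℝ, ∃ x, t ≤ x ∧ (0 ≤ t → g x = f (t + 1) - f t) := by
    intro t
    by_cases ht : 0 ≤ t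
    · obtain ⟨x, hx, hx'⟩ := exists_hasDerivAt_eq_slope f g (lt_add_one t)
        (fun y hy => ((hd y (ht.trans hy.1)).continuousWithinAt).mono
          fun z hz => ht.trans hz.1)
        (fun y hy => (hd y (ht.trans hy.1.le)).hasDerivAt (Ici_mem_nhds (ht.trans_lt hy.1)))
      exact ⟨x, hx.1.le, fun _ => by simpa using hx'⟩
    · exact ⟨t, le_rfl, fun h => absurd h ht⟩
  choose x hx hgx using hmv
  have h1 : Tendsto (fun t => g (x t)) atTop (𝓝 c) :=
    hg.comp (tendsto_atTop_mono hx tendsto_id)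
  have h2 : Tendsto (fun t => f (t + 1) - f t) atTop (𝓝 (a - a)) :=
    (hf.comp (tendsto_atTop_add_const_right _ 1 tendsto_id)).sub hf
  rw [sub_self] at h2
  refine tendsto_nhds_unique (h1.congr' ?_) h2
  filter_upwards [eventually_ge_atTop 0] with t ht using hgx t ht

/-! ### Cooperative systems between a sub- and a supersolution -/

section Cooperative

variable {V : Type*} {lo hi : V → ℝ} {F : V → (V → ℝ) → ℝ} {L : V → ℝ}

/-- A (possibly infinite) system `r' = F r` which is cooperative on the order interval `[lo, hi]`,
with `lo` a subsolution and `hi` a supersolution, has a monotone solution starting from `lo`. -/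
theorem exists_monotone_solution (hle : lo ≤ hi) (hL : ∀ i, 0 < L i)
    (hmono : ∀ i u v, lo ≤ u → u ≤ v → v ≤ hi → F i u + L i * u i ≤ F i v + L i * v i)
    (hlo : ∀ i, 0 ≤ F i lo) (hhi : ∀ i, F i hi ≤ 0)
    (hcont : ∀ i, ContinuousOn (F i) (Set.Icc lo hi)) :
    ∃ r : ℝ → V → ℝ, Monotone r ∧ r 0 = lo ∧ (∀ t, r t ∈ Set.Icc lo hi) ∧
      ∀ t, 0 ≤ t → ∀ i, HasDerivWithinAt (fun s => r s i) (F i (r t)) (Set.Ici 0) t := by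
  have : ∀ i, Fact (lo i ≤ hi i) := fun i => ⟨hle i⟩
  -- A product of compact intervals is a complete lattice, hence so is the set of monotone paths `ℝ
  -- →o X`.
  let X := ∀ i, Set.Icc (lo i) (hi i)
  let val : X → V → ℝ := fun x i => x i
  have hval : Monotone val := fun x y hxy i => hxy i
  have hvlo : ∀ x, lo ≤ val x := fun x i => (x i).2.1
  have hvhi : ∀ x, val x ≤ hi := fun x i => (x i).2.2
  let h : (ℝ →o X) → V → ℝ → ℝ := fun u i s => F i (val (u s)) + L i * val (u s) i
  have hh : ∀ u i, Monotone (h u i) := fun u i s t hst =>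
    hmono i _ _ (hvlo _) (hval (u.monotone hst)) (hvhi _)
  have hhuv : ∀ u v : ℝ →o X, u ≤ v → ∀ i s, h u i s ≤ h v i s := fun u v huv i s =>
    hmono i _ _ (hvlo _) (hval (huv s)) (hvhi _)
  have hha : ∀ u i t, lo i ≤ h u i t / L i := by
    intro u i t
    rw [le_div_iff₀' (hL i)]
    have := hmono i lo (val (u t)) le_rfl (hvlo _) (hvhi _)
    linarith [hlo i]
  have hhb : ∀ u i t, h u i t / L i ≤ hi i := by
    intro u i t
    rw [div_le_iff₀' (hL i)]
    have := hmono i (val (u t)) hi (hvlo _) (hvhi _) le_rfl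
    linarith [hhi i]
  -- Replacing `t` by `max t 0` extends paths to negative times by their value at `0`.
  have hm : ∀ u i, Monotone fun t => duhamel (L i) (lo i) (h u i) (max t 0) := by
    intro u i s t hst
    exact duhamel_monotoneOn (hL i) (hh u i) (hha u i) (le_max_right s 0) (le_max_right t 0)
      (max_le_max_right 0 hst)
  let op : (ℝ →o X) →o (ℝ →o X) :=
    { toFun := fun u =>
        { toFun := fun t i => ⟨duhamel (L i) (lo i) (h u i) (max t 0), by
            have h1 := duhamel_monotoneOn (hL i) (hh u i) (hha u i) (Set.mem_Ici.2 le_rfl)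
              (le_max_right t 0) (le_max_right t 0)
            rwa [duhamel_zero] at h1,
            (duhamel_le (hL i) (hh u i) (hha u i) (le_max_right t 0)).trans (hhb u i _)⟩
          monotone' := fun s t hst i => hm u i hst }
      monotone' := fun u v huv t i =>
        duhamel_mono (hh u i) (hh v i) (hhuv u v huv i) (le_max_right t 0) }
  let u : ℝ →o X := OrderHom.lfp op
  have hu : ∀ t i, val (u t) i = duhamel (L i) (lo i) (h u i) (max t 0) := by
    intro t i
    have h1 : op u = u := OrderHom.map_lfp (α := ℝ →o X) op
    conv_lhs => rw [← h1]
    rfl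
  -- Regularity bootstrap: the fixed point is a priori only monotone, the integral makes it
  -- continuous, then the forcing is continuous and the integral differentiable.
  have hc : Continuous fun t => val (u t) := by
    refine continuous_pi fun i => ?_
    simp only [hu]
    exact (continuous_duhamel (hh u i) _ _).comp (by fun_prop)
  have hch : ∀ i, Continuous (h u i) := fun i =>
    ((hcont i).comp_continuous hc fun t => ⟨hvlo _, hvhi _⟩).add
      (continuous_const.mul ((continuous_apply i).comp hc))
  refine ⟨fun t => val (u t), hval.comp u.monotone, ?_, fun t => ⟨hvlo _, hvhi _⟩, ?_⟩
  · funext i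
    simp only [hu, max_self, duhamel_zero]
  · intro t ht i
    have h1 := (hasDerivAt_duhamel (hch i) (L i) (lo i) t).hasDerivWithinAt (s := Set.Ici 0)
    have h2 : ∀ s ∈ Set.Ici (0 : ℝ), val (u s) i = duhamel (L i) (lo i) (h u i) s := by
      intro s hs
      rw [hu, max_eq_left hs]
    refine (h1.congr_of_mem h2 ht).congr_deriv ?_
    rw [← h2 t ht]
    simp [h]

/-- The monotone solution of `exists_monotone_solution` converges to a stationary point. -/
theorem exists_monotone_solution_tendsto (hle : lo ≤ hi) (hL : ∀ i, 0 < L i)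
    (hmono : ∀ i u v, lo ≤ u → u ≤ v → v ≤ hi → F i u + L i * u i ≤ F i v + L i * v i)
    (hlo : ∀ i, 0 ≤ F i lo) (hhi : ∀ i, F i hi ≤ 0)
    (hcont : ∀ i, ContinuousOn (F i) (Set.Icc lo hi)) :
    ∃ r : ℝ → V → ℝ, r 0 = lo ∧ (∀ t, r t ∈ Set.Icc lo hi) ∧
      (∀ t, 0 ≤ t → ∀ i, HasDerivWithinAt (fun s => r s i) (F i (r t)) (Set.Ici 0) t) ∧
      ∃ rlim ∈ Set.Icc lo hi, (∀ i, F i rlim = 0) ∧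
        ∀ i, Tendsto (fun t => r t i) atTop (𝓝 (rlim i)) := by
  obtain ⟨r, hr, hr0, hmem, hd⟩ := exists_monotone_solution hle hL hmono hlo hhi hcont
  have hlim : ∀ i, Tendsto (fun t => r t i) atTop (𝓝 (⨆ t, r t i)) := fun i =>
    tendsto_atTop_ciSup (fun s t hst => hr hst i) ⟨hi i, by
      rintro _ ⟨t, rfl⟩
      exact (hmem t).2 i⟩
  have hlim' : Tendsto r atTop (𝓝 fun i => ⨆ t, r t i) := tendsto_pi_nhds.2 hlim
  have hm : (fun i => ⨆ t, r t i) ∈ Set.Icc lo hi :=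
    isClosed_Icc.mem_of_tendsto hlim' (Eventually.of_forall hmem)
  refine ⟨r, hr0, hmem, hd, _, hm, fun i => ?_, hlim⟩
  have hF : Tendsto (fun t => F i (r t)) atTop (𝓝 (F i fun i => ⨆ t, r t i)) :=
    (hcont i _ hm).tendsto.comp
      (tendsto_nhdsWithin_iff.2 ⟨hlim', Eventually.of_forall hmem⟩)
  exact eq_zero_of_tendsto_of_hasDerivWithinAt (hlim i) hF fun t ht => hd t ht i

end Cooperative

end CRF

end
-- Angles of a hyperbolic triangle as functions of three radii
noncomputable section

namespace CRF

open Filter Topology Real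

/-- Hyperbolic cosine of the length of an edge with radii `a`, `b` and angle cosine `p`. -/
def coshLength (p a b : ℝ) : ℝ := cosh a * cosh b + p * sinh a * sinh b

/-- Cosine of the angle at the vertex of radius `a` in the triangle with radii `a`, `b`, `c`, where
`p`, `q`, `w` are the angle cosines on the edges `ab`, `ac`, `bc`. -/
def cosAngle (p q w a b c : ℝ) : ℝ :=
  (coshLength p a b * coshLength q a c - coshLength w b c) /
    (√(coshLength p a b ^ 2 - 1) * √(coshLength q a c ^ 2 - 1))

theorem coshLength_comm (p a b : ℝ) : coshLength p a b = coshLength p b a := by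
  unfold coshLength; ring

theorem cosh_mul_cosh_le_coshLength {p a b : ℝ} (hp : 0 ≤ p) (ha : 0 ≤ a) (hb : 0 ≤ b) :
    cosh a * cosh b ≤ coshLength p a b := by
  have := mul_nonneg (mul_nonneg hp (sinh_nonneg_iff.2 ha)) (sinh_nonneg_iff.2 hb)
  unfold coshLength
  linarith

theorem cosh_lt_coshLength {p a b : ℝ} (hp : 0 ≤ p) (ha : 0 < a) (hb : 0 ≤ b) :
    cosh b < coshLength p a b := by
  refine lt_of_lt_of_le ?_ (cosh_mul_cosh_le_coshLength hp ha.le hb)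
  have := one_lt_cosh.2 ha.ne'
  nlinarith [cosh_pos b]

theorem one_lt_coshLength {p a b : ℝ} (hp : 0 ≤ p) (ha : 0 < a) (hb : 0 ≤ b) :
    1 < coshLength p a b :=
  (one_le_cosh b).trans_lt (cosh_lt_coshLength hp ha hb)

theorem coshLength_le_cosh_add {p a b : ℝ} (hp : p ≤ 1) (ha : 0 ≤ a) (hb : 0 ≤ b) :
    coshLength p a b ≤ cosh (a + b) := by
  rw [cosh_add]
  unfold coshLength
  nlinarith [mul_nonneg (sinh_nonneg_iff.2 ha) (sinh_nonneg_iff.2 hb)]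

theorem lt_arcosh_coshLength {p a b : ℝ} (hp : 0 ≤ p) (ha : 0 < a) (hb : 0 ≤ b) :
    b < arcosh (coshLength p a b) := by
  have h1 := one_lt_coshLength hp ha hb
  have h2 := cosh_lt_coshLength hp ha hb
  rw [← cosh_arcosh h1.le, cosh_lt_cosh, abs_of_nonneg hb,
    abs_of_nonneg (arcosh_nonneg h1.le)] at h2
  exact h2

theorem arcosh_coshLength_le {p a b : ℝ} (h0 : 0 ≤ p) (hp : p ≤ 1) (ha : 0 < a) (hb : 0 ≤ b) :
    arcosh (coshLength p a b) ≤ a + b := by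
  have h1 := one_lt_coshLength h0 ha hb
  have h2 := coshLength_le_cosh_add hp ha.le hb
  rw [← cosh_arcosh h1.le, cosh_le_cosh, abs_of_nonneg (arcosh_nonneg h1.le),
    abs_of_nonneg (by positivity)] at h2
  exact h2

section

variable {p q w : ℝ} (hp : p ∈ Set.Icc (0 : ℝ) 1) (hq : q ∈ Set.Icc (0 : ℝ) 1)
  (hw : w ∈ Set.Icc (0 : ℝ) 1)

theorem sqrt_sq_sub_one_pos {x : ℝ} (hx : 1 < x) : 0 < √(x ^ 2 - 1) :=
  sqrt_pos.2 (by nlinarith)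

include hp hq hw in
-- Each length exceeds both of its radii and is at most their sum, which gives the strict triangle
-- inequalities; the addition formulas for `cosh` convert them into bounds on the cosine. Strictness
-- keeps `arccos` smooth.
theorem cosAngle_mem_Ioo {a b c : ℝ} (ha : 0 < a) (hb : 0 < b) (hc : 0 < c) :
    cosAngle p q w a b c ∈ Set.Ioo (-1 : ℝ) 1 := by
  have hx := one_lt_coshLength hp.1 ha hb.le
  have hy := one_lt_coshLength hq.1 ha hc.le
  have hz := one_lt_coshLength hw.1 hb hc.le
  have hxa := lt_arcosh_coshLength hp.1 hb ha.le
  have hxb := lt_arcosh_coshLength hp.1 ha hb.le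
  have hya := lt_arcosh_coshLength hq.1 hc ha.le
  have hyc := lt_arcosh_coshLength hq.1 ha hc.le
  have hzb := lt_arcosh_coshLength hw.1 hc hb.le
  have hzc := lt_arcosh_coshLength hw.1 hb hc.le
  have hxu := arcosh_coshLength_le hp.1 hp.2 ha hb.le
  have hyu := arcosh_coshLength_le hq.1 hq.2 ha hc.le
  have hzu := arcosh_coshLength_le hw.1 hw.2 hb hc.le
  rw [coshLength_comm] at hxa hya hzb
  have h1 : coshLength w b c < cosh (arcosh (coshLength p a b) + arcosh (coshLength q a c)) := by
    rw [← cosh_arcosh hz.le, cosh_lt_cosh, abs_of_pos (arcosh_pos hz),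
      abs_of_pos (add_pos (arcosh_pos hx) (arcosh_pos hy))]
    linarith
  have h2 : cosh (arcosh (coshLength p a b) - arcosh (coshLength q a c)) < coshLength w b c := by
    rw [← cosh_arcosh hz.le, cosh_lt_cosh, abs_of_pos (arcosh_pos hz), abs_lt]
    constructor <;> linarith
  rw [cosh_add, cosh_arcosh hx.le, cosh_arcosh hy.le, sinh_arcosh hx.le, sinh_arcosh hy.le] at h1
  rw [cosh_sub, cosh_arcosh hx.le, cosh_arcosh hy.le, sinh_arcosh hx.le, sinh_arcosh hy.le] at h2
  have hpos := mul_pos (sqrt_sq_sub_one_pos hx) (sqrt_sq_sub_one_pos hy)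
  constructor
  · rw [cosAngle, lt_div_iff₀ hpos]; linarith
  · rw [cosAngle, div_lt_iff₀ hpos]; linarith

include hp hq hw in
-- The numerator is at least the denominator minus `2 * cosh b * cosh c`, while the denominator is
-- at least `sinh a ^ 2 * cosh b * cosh c`. The factors in `b` and `c` cancel, so the bound is
-- uniform in them.
theorem one_sub_div_sinh_sq_le_cosAngle {a b c : ℝ} (ha : 0 < a) (hb : 0 < b) (hc : 0 < c) :
    1 - 2 / sinh a ^ 2 ≤ cosAngle p q w a b c := by
  have hsa := sinh_pos_iff.2 ha
  have key : ∀ {p b : ℝ}, p ∈ Set.Icc (0 : ℝ) 1 → 0 < b →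
      sinh a * cosh b ≤ √(coshLength p a b ^ 2 - 1) := by
    intro p b hp hb
    have h1 := cosh_mul_cosh_le_coshLength hp.1 ha.le hb.le
    refine le_sqrt_of_sq_le ?_
    have h2 : (cosh a * cosh b) ^ 2 ≤ coshLength p a b ^ 2 :=
      pow_le_pow_left₀ (by positivity) h1 2
    have h3 := cosh_sq a
    have h4 := one_le_cosh b
    rw [mul_pow, h3] at h2
    rw [mul_pow]
    nlinarith
  have hx := one_lt_coshLength hp.1 ha hb.le
  have hy := one_lt_coshLength hq.1 ha hc.le
  have hpos := mul_pos (sqrt_sq_sub_one_pos hx) (sqrt_sq_sub_one_pos hy)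
  have h1 := one_le_cosh (arcosh (coshLength p a b) - arcosh (coshLength q a c))
  rw [cosh_sub, cosh_arcosh hx.le, cosh_arcosh hy.le, sinh_arcosh hx.le, sinh_arcosh hy.le] at h1
  have h2 := mul_le_mul (key hp hb) (key hq hc) (by positivity) (sqrt_nonneg _)
  have h3 : coshLength w b c ≤ 2 * (cosh b * cosh c) := by
    have h4 := coshLength_le_cosh_add hw.2 hb.le hc.le
    rw [cosh_add] at h4
    have h5 := mul_le_mul (sinh_lt_cosh b).le (sinh_lt_cosh c).le (sinh_nonneg_iff.2 hc.le)
      (cosh_pos b).le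
    linarith
  rw [cosAngle, le_div_iff₀ hpos]
  have h6 : 2 / sinh a ^ 2 * (sinh a * cosh b * (sinh a * cosh c)) = 2 * (cosh b * cosh c) := by
    field_simp
  have h7 := mul_le_mul_of_nonneg_left h2 (show 0 ≤ 2 / sinh a ^ 2 by positivity)
  linarith

theorem hasDerivAt_coshLength (p a b : ℝ) :
    HasDerivAt (fun b => coshLength p a b) (cosh a * sinh b + p * sinh a * cosh b) b :=
  ((hasDerivAt_cosh b).const_mul _).add ((hasDerivAt_sinh b).const_mul _)

include hp hq hw in
-- The derivative in `b` has a closed form whose sign is visible once `p`, `q`, `w` are in `[0, 1]`;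
-- this is where non-obtuse intersection angles enter.
theorem cosAngle_antitoneOn {a c : ℝ} (ha : 0 < a) (hc : 0 < c) :
    AntitoneOn (fun b => cosAngle p q w a b c) (Set.Ioi 0) := by
  have hder : ∀ b, 0 < b → HasDerivAt (fun b => cosAngle p q w a b c)
      (-(sinh a * ((1 - p ^ 2) * sinh a * sinh b * cosh c + (w + p * q) * sinh a * cosh b * sinh c
        + (q + p * w) * cosh a * sinh b * sinh c)) /
        ((coshLength p a b ^ 2 - 1) * √(coshLength p a b ^ 2 - 1) *
          √(coshLength q a c ^ 2 - 1))) b := by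
    intro b hb
    have hx := one_lt_coshLength hp.1 ha hb.le
    have hy := one_lt_coshLength hq.1 ha hc.le
    have hx2 : 0 < coshLength p a b ^ 2 - 1 := by nlinarith
    have hX := sqrt_sq_sub_one_pos hx
    have hY := sqrt_sq_sub_one_pos hy
    have dx := hasDerivAt_coshLength p a b
    have dz : HasDerivAt (fun b => coshLength w b c) (cosh c * sinh b + w * sinh c * cosh b) b := by
      simpa only [coshLength_comm w c] using hasDerivAt_coshLength w c b
    have dn := (dx.mul_const (coshLength q a c)).sub dz
    have dd := (((dx.pow 2).sub_const 1).sqrt hx2.ne').mul_const √(coshLength q a c ^ 2 - 1)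
    have d := dn.div dd (mul_pos hX hY).ne'
    refine d.congr_deriv ?_
    have hX2 : √(coshLength p a b ^ 2 - 1) ^ 2 = coshLength p a b ^ 2 - 1 := sq_sqrt hx2.le
    simp only [Pi.sub_apply, Pi.pow_apply]
    set X := √(coshLength p a b ^ 2 - 1) with hXdef
    set Y := √(coshLength q a c ^ 2 - 1) with hYdef
    rw [← hX2]
    -- Numerator of the quotient rule. With `x`, `y`, `z` the three `coshLength`s and `X ^ 2 = x ^ 2
    -- - 1`, it equals `z' - x' * y - x * (x * z' - x' * z)`; `e` evaluates the inner bracket and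
    -- `e'` the rest.
    have main : (cosh a * sinh b + p * sinh a * cosh b) * coshLength q a c * X ^ 2
        - (cosh c * sinh b + w * sinh c * cosh b) * X ^ 2
        - (coshLength p a b * coshLength q a c - coshLength w b c) * coshLength p a b *
          (cosh a * sinh b + p * sinh a * cosh b) =
        -(sinh a * ((1 - p ^ 2) * sinh a * sinh b * cosh c + (w + p * q) * sinh a * cosh b * sinh c
        + (q + p * w) * cosh a * sinh b * sinh c)) := by
      rw [hX2]
      have e : coshLength p a b * (cosh c * sinh b + w * sinh c * cosh b) -
          (cosh a * sinh b + p * sinh a * cosh b) * coshLength w b c =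
          w * cosh a * sinh c - p * sinh a * cosh c := by
        unfold coshLength
        linear_combination (w * cosh a * sinh c - p * sinh a * cosh c) * cosh_sq b
      have e' : cosh c * sinh b + w * sinh c * cosh b -
          (cosh a * sinh b + p * sinh a * cosh b) * coshLength q a c -
          coshLength p a b * (w * cosh a * sinh c - p * sinh a * cosh c) =
          -(sinh a * ((1 - p ^ 2) * sinh a * sinh b * cosh c
            + (w + p * q) * sinh a * cosh b * sinh c
            + (q + p * w) * cosh a * sinh b * sinh c)) := by
        unfold coshLength
        linear_combination (-(w * cosh b * sinh c + sinh b * cosh c)) * cosh_sq a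
      rw [← e']
      linear_combination (-coshLength p a b) * e
    rw [← main]
    field_simp
    ring
  refine antitoneOn_of_deriv_nonpos (convex_Ioi 0)
    (fun b hb => (hder b hb).continuousAt.continuousWithinAt) ?_ ?_
  · rw [interior_Ioi]
    exact fun b hb => (hder b hb).differentiableAt.differentiableWithinAt
  · rw [interior_Ioi]
    intro b hb
    rw [(hder b hb).deriv]
    have hx := one_lt_coshLength hp.1 ha (le_of_lt hb)
    have hx2 : 0 < coshLength p a b ^ 2 - 1 := by nlinarith
    have hsa := sinh_nonneg_iff.2 ha.le
    have hsb := sinh_nonneg_iff.2 (le_of_lt hb)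
    have hsc := sinh_nonneg_iff.2 hc.le
    have hp0 := hp.1
    have hq0 := hq.1
    have hw0 := hw.1
    have hp2 : 0 ≤ 1 - p ^ 2 := by nlinarith [hp.2]
    rw [neg_div]
    exact neg_nonpos.2 (by positivity)

include hp hq hw in
theorem contDiffAt_arccos_cosAngle {x : ℝ × ℝ × ℝ} (ha : 0 < x.1) (hb : 0 < x.2.1)
    (hc : 0 < x.2.2) :
    ContDiffAt ℝ 1 (fun x : ℝ × ℝ × ℝ => arccos (cosAngle p q w x.1 x.2.1 x.2.2)) x := by
  have hx := one_lt_coshLength hp.1 ha hb.le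
  have hy := one_lt_coshLength hq.1 ha hc.le
  have hX := sqrt_sq_sub_one_pos hx
  have hY := sqrt_sq_sub_one_pos hy
  have hm := cosAngle_mem_Ioo hp hq hw ha hb hc
  have c1 : ContDiffAt ℝ 1 (fun x : ℝ × ℝ × ℝ => coshLength p x.1 x.2.1) x := by
    unfold coshLength; fun_prop
  have c2 : ContDiffAt ℝ 1 (fun x : ℝ × ℝ × ℝ => coshLength q x.1 x.2.2) x := by
    unfold coshLength; fun_prop
  have c3 : ContDiffAt ℝ 1 (fun x : ℝ × ℝ × ℝ => coshLength w x.2.1 x.2.2) x := by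
    unfold coshLength; fun_prop
  have c : ContDiffAt ℝ 1 (fun x : ℝ × ℝ × ℝ => cosAngle p q w x.1 x.2.1 x.2.2) x := by
    unfold cosAngle
    exact ((c1.mul c2).sub c3).div
      ((((c1.pow 2).sub contDiffAt_const).sqrt (by nlinarith)).mul
        (((c2.pow 2).sub contDiffAt_const).sqrt (by nlinarith))) (mul_pos hX hY).ne'
  exact ContDiffAt.comp (g := arccos) x (contDiffAt_arccos hm.1.ne' hm.2.ne) c

end

/-- A function that is `C¹` near a compact convex set is Lipschitz on it. -/
theorem exists_norm_sub_le_of_contDiffAt {E : Type*} [NormedAddCommGroup E] [NormedSpace ℝ E]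
    {f : E → ℝ} {s : Set E} (hf : ∀ x ∈ s, ContDiffAt ℝ 1 f x) (hs : IsCompact s)
    (hc : Convex ℝ s) : ∃ C, 0 ≤ C ∧ ∀ x ∈ s, ∀ y ∈ s, ‖f y - f x‖ ≤ C * ‖y - x‖ := by
  have h1 : ContinuousOn (fun x => fderiv ℝ f x) s := fun x hx =>
    ((hf x hx).fderiv_right (m := 0) (by simp)).continuousAt.continuousWithinAt
  obtain ⟨C, hC⟩ := hs.exists_bound_of_continuousOn h1
  refine ⟨max C 0, le_max_right _ _, fun x hx y hy => ?_⟩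
  exact hc.norm_image_sub_le_of_norm_fderiv_le
    (fun z hz => (hf z hz).differentiableAt (by simp))
    (fun z hz => (hC z hz).trans (le_max_left _ _)) hx hy

end CRF

end
-- Curvature of circle-packing metrics on the triangulation
noncomputable section

namespace CRF

open Filter Topology

variable {V : Type*} {T : AbstractSimplicialComplex V} {Φ : Sym2 V → ℝ}

theorem IsTriangle.isEdge {i j k : V} (h : IsTriangle T i j k) : IsEdge T i j := by
  classical
  obtain ⟨hij, -, -, s, hs, hst⟩ := h
  refine ⟨hij, {i, j}, (T.isRelLowerSet_faces hs).2 ?_ (by simp), by simp⟩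
  rw [← Finset.coe_subset, hst]
  intro x
  simp only [Finset.coe_insert, Finset.coe_singleton, Set.mem_insert_iff, Set.mem_singleton_iff]
  tauto

theorem IsTriangle.swap {i j k : V} (h : IsTriangle T i j k) : IsTriangle T i k j := by
  obtain ⟨hij, hik, hjk, s, hs, hst⟩ := h
  exact ⟨hik, hij, hjk.symm, s, hs, by rw [hst, Set.pair_comm j k]⟩

theorem IsTriangle.rotate {i j k : V} (h : IsTriangle T i j k) : IsTriangle T j k i := by
  obtain ⟨hij, hik, hjk, s, hs, hst⟩ := h
  refine ⟨hjk, hij.symm, hik.symm, s, hs, ?_⟩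
  rw [hst]
  ext x
  simp only [Set.mem_insert_iff, Set.mem_singleton_iff]
  tauto

theorem IsEdge.cos_mem (hΦ : ∀ e ∈ (skeleton T).edgeSet, Φ e ∈ Set.Icc 0 (Real.pi / 2))
    {i j : V} (h : IsEdge T i j) : Real.cos (Φ s(i, j)) ∈ Set.Icc (0 : ℝ) 1 := by
  have h1 := hΦ s(i, j) ((SimpleGraph.mem_edgeSet _).2 h)
  exact ⟨Real.cos_nonneg_of_mem_Icc ⟨by linarith [h1.1, Real.pi_pos], h1.2⟩, Real.cos_le_one _⟩

theorem innerAngle_eq_arccos_cosAngle {r : V → ℝ} (hr : IsCirclePackingMetric r) {i j k : V}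
    (hij : 0 ≤ Real.cos (Φ s(i, j))) (hik : 0 ≤ Real.cos (Φ s(i, k)))
    (hjk : 0 ≤ Real.cos (Φ s(j, k))) :
    innerAngle Φ r i j k = Real.arccos (cosAngle (Real.cos (Φ s(i, j))) (Real.cos (Φ s(i, k)))
      (Real.cos (Φ s(j, k))) (r i) (r j) (r k)) := by
  have h1 := one_lt_coshLength hij (hr i) (hr j).le
  have h2 := one_lt_coshLength hik (hr i) (hr k).le
  have h3 := one_lt_coshLength hjk (hr j) (hr k).le
  change Real.arccos ((Real.cosh (Real.arcosh (coshLength _ (r i) (r j))) *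
      Real.cosh (Real.arcosh (coshLength _ (r i) (r k))) -
      Real.cosh (Real.arcosh (coshLength _ (r j) (r k)))) /
    (Real.sinh (Real.arcosh (coshLength _ (r i) (r j))) *
      Real.sinh (Real.arcosh (coshLength _ (r i) (r k))))) = _
  rw [Real.cosh_arcosh h1.le, Real.cosh_arcosh h2.le, Real.cosh_arcosh h3.le,
    Real.sinh_arcosh h1.le, Real.sinh_arcosh h2.le, cosAngle]

theorem finite_oppositeEdges (hT : ∀ i : V, {s ∈ T.faces | i ∈ s}.Finite) (i : V) :
    (oppositeEdges T i).Finite := by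
  classical
  refine ((hT i).biUnion fun s _ => s.sym2.finite_toSet).subset ?_
  rintro e ⟨j, k, rfl, -, -, -, s, hs, hst⟩
  have hmem : ∀ x, x ∈ s ↔ x = i ∨ x = j ∨ x = k := fun x => by
    rw [← Finset.mem_coe, hst]; simp
  simp only [Set.mem_iUnion]
  exact ⟨s, ⟨hs, by simp [hmem]⟩, by simp [hmem]⟩

theorem curvature_eq_sum (hT : ∀ i : V, {s ∈ T.faces | i ∈ s}.Finite) (r : V → ℝ) (i : V) :
    curvature T Φ r i = 2 * Real.pi -
      ∑ e ∈ (finite_oppositeEdges hT i).toFinset, innerAngleOpp Φ r i e := by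
  rw [curvature, finsum_mem_eq_finite_toFinset_sum]

section Angle

variable (hΦ : ∀ e ∈ (skeleton T).edgeSet, Φ e ∈ Set.Icc 0 (Real.pi / 2))
  {i j k : V} (h : IsTriangle T i j k)

include hΦ h in
theorem IsTriangle.cos_mem : Real.cos (Φ s(i, j)) ∈ Set.Icc (0 : ℝ) 1 ∧
    Real.cos (Φ s(i, k)) ∈ Set.Icc (0 : ℝ) 1 ∧ Real.cos (Φ s(j, k)) ∈ Set.Icc (0 : ℝ) 1 :=
  ⟨h.isEdge.cos_mem hΦ, h.swap.isEdge.cos_mem hΦ, h.rotate.isEdge.cos_mem hΦ⟩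

include hΦ h in
theorem innerAngle_eq {r : V → ℝ} (hr : IsCirclePackingMetric r) :
    innerAngle Φ r i j k = Real.arccos (cosAngle (Real.cos (Φ s(i, j))) (Real.cos (Φ s(i, k)))
      (Real.cos (Φ s(j, k))) (r i) (r j) (r k)) :=
  have hc := h.cos_mem hΦ
  innerAngle_eq_arccos_cosAngle hr hc.1.1 hc.2.1.1 hc.2.2.1

include hΦ h in
theorem continuousOn_innerAngle :
    ContinuousOn (fun r => innerAngle Φ r i j k) {r | IsCirclePackingMetric r} := by
  obtain ⟨hp, hq, hw⟩ := h.cos_mem hΦ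
  refine ContinuousOn.congr (f := fun r : V → ℝ => Real.arccos (cosAngle (Real.cos (Φ s(i, j)))
    (Real.cos (Φ s(i, k))) (Real.cos (Φ s(j, k))) (r i) (r j) (r k))) ?_
    fun r hr => innerAngle_eq hΦ h hr
  intro r hr
  have h1 := (contDiffAt_arccos_cosAngle (x := (r i, r j, r k)) hp hq hw (hr i) (hr j)
    (hr k)).continuousAt
  have h2 : ContinuousAt (fun r : V → ℝ => (r i, r j, r k)) r := by fun_prop
  exact (ContinuousAt.comp (f := fun r : V → ℝ => (r i, r j, r k)) h1 h2).continuousWithinAt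

include hΦ h in
/-- The angle at `i` increases with the two other radii. -/
theorem innerAngle_le_innerAngle {u v : V → ℝ} (hu : IsCirclePackingMetric u)
    (huv : u ≤ v) (hi : u i = v i) : innerAngle Φ u i j k ≤ innerAngle Φ v i j k := by
  classical
  obtain ⟨hp, hq, hw⟩ := h.cos_mem hΦ
  have hv : IsCirclePackingMetric v := fun x => (hu x).trans_le (huv x)
  -- Intermediate metric: the radius at `j` is raised first, with that at `k` kept at `u k`, and
  -- then the radius at `k`.
  have hx : IsCirclePackingMetric (Function.update v k (u k)) := by
    intro x
    rcases eq_or_ne x k with rfl | hxk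
    · simpa using hu x
    · simpa [hxk] using hv x
  have hik := h.2.1
  have hjk := h.2.2.1
  calc innerAngle Φ u i j k ≤ innerAngle Φ (Function.update v k (u k)) i j k := by
        rw [innerAngle_eq hΦ h hu, innerAngle_eq hΦ h hx]
        simp only [ne_eq, hik, not_false_eq_true, Function.update_of_ne, hjk, Function.update_self,
          ← hi]
        exact Real.arccos_le_arccos
          (cosAngle_antitoneOn hp hq hw (hu i) (hu k) (hu j) (hv j) (huv j))
    _ = innerAngle Φ (Function.update v k (u k)) i k j := innerAngle_comm ..
    _ ≤ innerAngle Φ v i k j := by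
        rw [innerAngle_eq hΦ h.swap hv, innerAngle_eq hΦ h.swap hx]
        simp only [ne_eq, hik, not_false_eq_true, Function.update_of_ne, hjk, Function.update_self]
        rw [Sym2.eq_swap (a := k) (b := j)]
        exact Real.arccos_le_arccos
          (cosAngle_antitoneOn hq hp hw (hv i) (hv j) (hu k) (hv k) (huv k))
    _ = innerAngle Φ v i j k := innerAngle_comm ..

include hΦ h in
-- Raising the other two radii only increases the angle. Raising the radius at `i` changes the term
-- at most at a Lipschitz rate, uniform because only three radii in a compact box matter; `C`
-- compensates for it.
theorem exists_innerAngle_mul_sinh_add_le {lo hi : V → ℝ} (hlo : IsCirclePackingMetric lo) :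
    ∃ C, 0 ≤ C ∧ ∀ u v, lo ≤ u → u ≤ v → v ≤ hi →
      innerAngle Φ u i j k * Real.sinh (u i) + C * u i ≤
        innerAngle Φ v i j k * Real.sinh (v i) + C * v i := by
  classical
  obtain ⟨hp, hq, hw⟩ := h.cos_mem hΦ
  let f : ℝ × ℝ × ℝ → ℝ := fun x => Real.arccos (cosAngle (Real.cos (Φ s(i, j)))
    (Real.cos (Φ s(i, k))) (Real.cos (Φ s(j, k))) x.1 x.2.1 x.2.2) * Real.sinh x.1
  obtain ⟨C, hC0, hC⟩ := exists_norm_sub_le_of_contDiffAt (f := f)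
    (s := Set.Icc (lo i, lo j, lo k) (hi i, hi j, hi k))
    (fun x hx => (contDiffAt_arccos_cosAngle hp hq hw ((hlo i).trans_le hx.1.1)
      ((hlo j).trans_le hx.1.2.1) ((hlo k).trans_le hx.1.2.2)).mul (by fun_prop))
    isCompact_Icc (convex_Icc _ _)
  refine ⟨C, hC0, fun u v hu huv hv => ?_⟩
  have hu0 : IsCirclePackingMetric u := fun x => (hlo x).trans_le (hu x)
  have hv0 : IsCirclePackingMetric v := fun x => (hu0 x).trans_le (huv x)
  have hx0 : IsCirclePackingMetric (Function.update u i (v i)) := by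
    intro x
    rcases eq_or_ne x i with rfl | hx
    · simpa using hv0 x
    · simpa [hx] using hu0 x
  have hij := h.1.symm
  have hik := h.2.1.symm
  have h1 : innerAngle Φ (Function.update u i (v i)) i j k ≤ innerAngle Φ v i j k := by
    refine innerAngle_le_innerAngle hΦ h hx0 (fun x => ?_) (by simp)
    rcases eq_or_ne x i with rfl | hx
    · simp
    · simpa [hx] using huv x
  have h2 := mul_le_mul_of_nonneg_right h1 (Real.sinh_nonneg_iff.2 (hv0 i).le)
  have h3 := hC (u i, u j, u k) ⟨⟨hu i, hu j, hu k⟩, huv.trans hv i, huv.trans hv j,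
    huv.trans hv k⟩ (v i, u j, u k) ⟨⟨hu.trans huv i, hu j, hu k⟩, hv i, huv.trans hv j,
    huv.trans hv k⟩
  have h4 : ‖((v i, u j, u k) : ℝ × ℝ × ℝ) - (u i, u j, u k)‖ = v i - u i := by
    have := huv i
    simp [Prod.norm_def, abs_of_nonneg (sub_nonneg.2 this), this]
  rw [h4, Real.norm_eq_abs] at h3
  have h5 := (abs_le.1 h3).1
  have h6 : f (u i, u j, u k) = innerAngle Φ u i j k * Real.sinh (u i) := by
    rw [innerAngle_eq hΦ h hu0]
  have h7 : f (v i, u j, u k) =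
      innerAngle Φ (Function.update u i (v i)) i j k * Real.sinh (v i) := by
    rw [innerAngle_eq hΦ h hx0]
    simp [f, hij, hik]
  rw [h6, h7] at h5
  linarith

include hΦ h in
theorem innerAngle_le {r : V → ℝ} (hr : IsCirclePackingMetric r) :
    innerAngle Φ r i j k ≤ Real.arccos (1 - 2 / Real.sinh (r i) ^ 2) := by
  obtain ⟨hp, hq, hw⟩ := h.cos_mem hΦ
  rw [innerAngle_eq hΦ h hr]
  exact Real.arccos_le_arccos
    (one_sub_div_sinh_sq_le_cosAngle hp hq hw (hr i) (hr j) (hr k))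

end Angle

theorem exists_arccos_one_sub_div_sinh_sq_lt {ε : ℝ} (hε : 0 < ε) :
    ∃ M : ℝ, ∀ a, M ≤ a → Real.arccos (1 - 2 / Real.sinh a ^ 2) < ε := by
  have h1 : Tendsto Real.sinh atTop atTop :=
    tendsto_atTop_mono' _ ((eventually_ge_atTop 0).mono fun x hx => Real.self_le_sinh_iff.2 hx)
      tendsto_id
  have h2 : Tendsto (fun a => 1 - 2 / Real.sinh a ^ 2) atTop (𝓝 (1 - 0)) :=
    tendsto_const_nhds.sub
      (((tendsto_pow_atTop two_ne_zero).comp h1).const_div_atTop 2)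
  have h3 := (Real.continuous_arccos.tendsto _).comp h2
  rw [sub_zero, Real.arccos_one] at h3
  exact eventually_atTop.1 (h3.eventually (gt_mem_nhds hε))

/-- A large radius forces positive curvature, however large the other radii are. -/
theorem exists_forall_curvature_pos (hT : ∀ i : V, {s ∈ T.faces | i ∈ s}.Finite)
    (hΦ : ∀ e ∈ (skeleton T).edgeSet, Φ e ∈ Set.Icc 0 (Real.pi / 2)) (i : V) :
    ∃ M, ∀ r, IsCirclePackingMetric r → M ≤ r i → 0 < curvature T Φ r i := by
  set S := (finite_oppositeEdges hT i).toFinset with hS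
  -- With `card + 1` in the denominator, `card` such angles sum to strictly less than `2π`, also
  -- when `card = 0`.
  obtain ⟨M, hM⟩ := exists_arccos_one_sub_div_sinh_sq_lt
    (ε := 2 * Real.pi / (S.card + 1)) (by positivity)
  refine ⟨M, fun r hr hMr => ?_⟩
  have h1 : ∀ e ∈ S, innerAngleOpp Φ r i e ≤ 2 * Real.pi / (S.card + 1) := by
    intro e he
    rw [hS, Set.Finite.mem_toFinset] at he
    obtain ⟨j, k, rfl, h⟩ := he
    exact (innerAngle_le hΦ h hr).trans (hM _ hMr).le
  have h2 := Finset.sum_le_card_nsmul _ _ _ h1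
  rw [curvature_eq_sum hT, sub_pos]
  refine h2.trans_lt ?_
  rw [nsmul_eq_mul, mul_div_assoc', div_lt_iff₀ (by positivity)]
  nlinarith [Real.pi_pos]

theorem neg_curvature_mul_sinh (hT : ∀ i : V, {s ∈ T.faces | i ∈ s}.Finite) (r : V → ℝ) (i : V) :
    -curvature T Φ r i * Real.sinh (r i) =
      ∑ e ∈ (finite_oppositeEdges hT i).toFinset, innerAngleOpp Φ r i e * Real.sinh (r i)
        - 2 * Real.pi * Real.sinh (r i) := by
  rw [curvature_eq_sum hT, ← Finset.sum_mul]
  ring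

theorem continuousOn_neg_curvature_mul_sinh (hT : ∀ i : V, {s ∈ T.faces | i ∈ s}.Finite)
    (hΦ : ∀ e ∈ (skeleton T).edgeSet, Φ e ∈ Set.Icc 0 (Real.pi / 2)) (i : V) :
    ContinuousOn (fun r => -curvature T Φ r i * Real.sinh (r i))
      {r | IsCirclePackingMetric r} := by
  simp only [neg_curvature_mul_sinh hT]
  refine (continuousOn_finsetSum _ fun e he => ?_).sub (by fun_prop)
  rw [Set.Finite.mem_toFinset] at he
  obtain ⟨j, k, rfl, h⟩ := he
  exact (continuousOn_innerAngle hΦ h).mul (by fun_prop)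

theorem exists_neg_curvature_mul_sinh_add_le (hT : ∀ i : V, {s ∈ T.faces | i ∈ s}.Finite)
    (hΦ : ∀ e ∈ (skeleton T).edgeSet, Φ e ∈ Set.Icc 0 (Real.pi / 2)) {lo hi : V → ℝ}
    (hlo : IsCirclePackingMetric lo) (i : V) :
    ∃ C, 0 < C ∧ ∀ u v, lo ≤ u → u ≤ v → v ≤ hi →
      -curvature T Φ u i * Real.sinh (u i) + C * u i ≤
        -curvature T Φ v i * Real.sinh (v i) + C * v i := by
  set S := (finite_oppositeEdges hT i).toFinset with hS
  have h1 : ∀ e : S, ∃ C, 0 ≤ C ∧ ∀ u v, lo ≤ u → u ≤ v → v ≤ hi →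
      innerAngleOpp Φ u i e * Real.sinh (u i) + C * u i ≤
        innerAngleOpp Φ v i e * Real.sinh (v i) + C * v i := by
    rintro ⟨e, he⟩
    rw [hS, Set.Finite.mem_toFinset] at he
    obtain ⟨j, k, rfl, h⟩ := he
    exact exists_innerAngle_mul_sinh_add_le hΦ h hlo
  choose C hC0 hC using h1
  obtain ⟨D, hD0, hD⟩ := exists_norm_sub_le_of_contDiffAt (f := Real.sinh)
    (s := Set.Icc (lo i) (hi i)) (fun x _ => by fun_prop) isCompact_Icc (convex_Icc _ _)
  have hCs : 0 ≤ ∑ e, C e := Finset.sum_nonneg fun e _ => hC0 e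
  -- The face constants, plus a Lipschitz bound for the term `-2π * sinh`, plus `1` for strict
  -- positivity.
  refine ⟨∑ e, C e + 2 * Real.pi * D + 1, by positivity, fun u v hu huv hv => ?_⟩
  have h2 : ∑ e : S, (innerAngleOpp Φ u i e * Real.sinh (u i) + C e * u i) ≤
      ∑ e : S, (innerAngleOpp Φ v i e * Real.sinh (v i) + C e * v i) :=
    Finset.sum_le_sum fun e _ => hC e u v hu huv hv
  have h3 := hD (u i) ⟨hu i, huv.trans hv i⟩ (v i) ⟨hu.trans huv i, hv i⟩
  rw [Real.norm_eq_abs, Real.norm_eq_abs, abs_of_nonneg (sub_nonneg.2 (huv i))] at h3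
  have h4 := mul_le_mul_of_nonneg_left ((le_abs_self _).trans h3) Real.two_pi_pos.le
  simp only [Finset.sum_add_distrib, ← Finset.sum_mul] at h2
  rw [Finset.sum_coe_sort S (innerAngleOpp Φ u i),
    Finset.sum_coe_sort S (innerAngleOpp Φ v i)] at h2
  rw [curvature_eq_sum hT, curvature_eq_sum hT, ← hS]
  linarith [huv i]

end CRF

end

theorem theorem1p3 {V : Type*} (T : AbstractSimplicialComplex V)
    (hT : CRF.IsInfiniteDiskTriangulation T)
    (Φ : Sym2 V → ℝ)
    (hΦ : ∀ e ∈ (CRF.skeleton T).edgeSet, Φ e ∈ Set.Icc 0 (Real.pi / 2))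
    (r₀ : V → ℝ) (hr₀ : CRF.IsCirclePackingMetric r₀)
    (hK : ∀ i, CRF.curvature T Φ r₀ i ≤ 0) :
    ∃ r : ℝ → V → ℝ, CRF.IsHyperbolicCRF T Φ r ∧ r 0 = r₀ ∧
      ∃ rlim : V → ℝ, CRF.IsCirclePackingMetric rlim ∧
        (∀ i, CRF.curvature T Φ rlim i = 0) ∧
        ∀ i, Filter.Tendsto (fun t => r t i) Filter.atTop (nhds (rlim i)) := by
  have hfin := hT.locallyFinite
  choose M hM using CRF.exists_forall_curvature_pos hfin hΦ
  -- A radius above `M i` would force positive curvature, against `hK`.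
  have hle : r₀ ≤ M := fun i => by
    by_contra hi
    exact (hM i r₀ hr₀ (not_le.1 hi).le).not_ge (hK i)
  have hpos : ∀ u : V → ℝ, r₀ ≤ u → CRF.IsCirclePackingMetric u :=
    fun u hu i => (hr₀ i).trans_le (hu i)
  choose L hL0 hL using
    CRF.exists_neg_curvature_mul_sinh_add_le (hi := M) hfin hΦ hr₀
  -- `M` is itself a metric, and its curvature at `i` is positive whatever its other radii are, so
  -- it is a supersolution.
  obtain ⟨r, hr0, hmem, hd, rlim, hrlim, hzero, hlim⟩ :=
    CRF.exists_monotone_solution_tendsto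
      (F := fun i r => -CRF.curvature T Φ r i * Real.sinh (r i)) hle hL0 hL
      (fun i => mul_nonneg (neg_nonneg.2 (hK i)) (Real.sinh_nonneg_iff.2 (hr₀ i).le))
      (fun i => mul_nonpos_of_nonpos_of_nonneg
        (neg_nonpos.2 (hM i M (hpos M hle) le_rfl).le)
        (Real.sinh_nonneg_iff.2 (hpos M hle i).le))
      (fun i => (CRF.continuousOn_neg_curvature_mul_sinh hfin hΦ i).mono
        fun u hu => hpos u hu.1)
  refine ⟨r, ⟨fun t _ => hpos _ (hmem t).1, hd⟩, hr0, rlim, hpos _ hrlim.1, fun i => ?_, hlim⟩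
  have h1 := (Real.sinh_pos_iff.2 (hpos _ hrlim.1 i)).ne'
  simpa [h1] using hzero i
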